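/- Let $n=2k+1$ be an odd positive integer. Let $\mathrm{Spin}(n)$ be the spin group, contained in the Clifford algebra of $\mathbb{R}^n$ with the relations $v^2=-\|v\|^2$. Let $\Delta_n=\mathbb{C}^2\otimes\cdots\otimes\mathbb{C}^2$ ($k$ factors) be the complex spinor space, on which the Clifford algebra acts through $$e_{2j-1}\mapsto 1\otimes\cdots\otimes 1\otimes g_1\otimes \underbrace{T\otimes\cdots\otimes T}_{j-1},\qquad e_{2j}\mapsto 1\otimes\cdots\otimes 1\otimes g_2\otimes \underbrace{T\otimes\cdots\otimes T}_{j-1}\qquad(1\le j\le k),$$ $$e_{2k+1}\mapsto i\,T\otimes\cdots\otimes T,$$ where $g_1=\begin{pmatrix} i&0\\0&-i\end{pmatrix}$, $g_2=\begin{pmatrix}0&i\\ i&0\end{pmatrix}$, $T=\begin{pmatrix}0&-i\\ i&0\end{pmatrix}$. Let $\kappa:\mathrm{Spin}(n)\to GL(\Delta_n)$ be the restriction of this action (the spin representation). Let $$\mathrm{Spin}^T(n)=(\mathrm{Spin}(n)\times S^1\times S^1)/\{\pm1\},$$ where $\{\pm 1\}=\{(1,1,1),(-1,-1,-1)\}$,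 and write $[g,z_1,z_2]$ for the class of $(g,z_1,z_2)$. Let $\kappa^T$ be the (well defined) representation of $\mathrm{Spin}^T(n)$ on $\Delta_n$ given by $$\kappa^T[g,z_1,z_2]\psi=z_1^2z_2\,\kappa(g)\psi .$$ Then $\kappa^T$ is irreducible: $\Delta_n\neq 0$, and the only complex linear subspaces of $\Delta_n$ invariant under $\mathrm{Spin}^T(n)$ are $0$ and $\Delta_n$. -/

import Mathlib

noncomputable section

namespace SpinRep

/-! ### The groups `Spin(n)` and `Spin^T(n)` -/

/-- The negative definite quadratic form `v ↦ -(v₁² + ⋯ + vₙ²)` on `ℝⁿ`. -/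
abbrev form (n : ℕ) : QuadraticForm ℝ (Fin n → ℝ) :=
  QuadraticMap.weightedSumSquares ℝ (fun _ : Fin n => (-1 : ℝ))

/-- The real Clifford algebra of `ℝⁿ`, in which `v² = -‖v‖²`. -/
abbrev Cl (n : ℕ) : Type := CliffordAlgebra (form n)

/-- The group `Spin(n)`, inside the Clifford algebra. -/
abbrev Spin (n : ℕ) : Type := spinGroup (form n)

/-- The subgroup `{±1} = {(1, 1, 1), (-1, -1, -1)}` of `Spin(n) × S¹ × S¹`. -/
def signSubgroup (n : ℕ) : Subgroup (Spin n × Circle × Circle) where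
  carrier := {x | x = 1 ∨
    ((x.1 : Cl n) = -1 ∧ (x.2.1 : ℂ) = -1 ∧ (x.2.2 : ℂ) = -1)}
  one_mem' := Or.inl rfl
  mul_mem' := by
    rintro a b (rfl | ⟨h1, h2, h3⟩) (rfl | ⟨k1, k2, k3⟩)
    · left; simp
    · right; simpa using ⟨k1, k2, k3⟩
    · right; simpa using ⟨h1, h2, h3⟩
    · left
      refine Prod.ext (Subtype.ext ?_) (Prod.ext (Circle.ext ?_) (Circle.ext ?_))
      · simp [h1, k1]
      · simp [h2, k2]
      · simp [h3, k3]
  inv_mem' := by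
    rintro a (rfl | ⟨h1, h2, h3⟩)
    · left; simp
    · right
      refine ⟨?_, ?_, ?_⟩
      · change star (a.1 : Cl n) = -1
        rw [h1]; simp
      · simp [h2]
      · simp [h3]

instance signSubgroup_normal (n : ℕ) : (signSubgroup n).Normal where
  conj_mem := by
    rintro a (rfl | ⟨h1, h2, h3⟩) g
    · left; simp
    · right
      have hg : ((g.1 : Spin n) : Cl n) * ((g.1⁻¹ : Spin n) : Cl n) = 1 :=
        spinGroup.coe_mul_star_self g.1
      refine ⟨?_, ?_, ?_⟩
      · simp [h1, hg]
      · simp [h2]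
      · simp [h3]

/-- `Spin^T(n) = (Spin(n) × S¹ × S¹) / {±1}`. -/
abbrev SpinT (n : ℕ) : Type := (Spin n × Circle × Circle) ⧸ signSubgroup n

/-- The class `[g, z₁, z₂]`. -/
abbrev SpinT.mk {n : ℕ} (g : Spin n) (z₁ z₂ : Circle) : SpinT n :=
  QuotientGroup.mk (g, z₁, z₂)

/-! ### Spinors -/

/-- The index set of the standard basis `e_{s 0} ⊗ ⋯ ⊗ e_{s (k-1)}` of the `k`-fold tensor product
`ℂ² ⊗ ⋯ ⊗ ℂ²`, where `k = ⌊n/2⌋`. -/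
abbrev Idx (n : ℕ) : Type := Fin (n / 2) → Fin 2

/-- The space `Δₙ = ℂ² ⊗ ⋯ ⊗ ℂ²` of complex spinors, with `⌊n/2⌋` factors, in coordinates with
respect to the standard basis; its dimension is `2 ^ ⌊n/2⌋`. -/
abbrev Spinor (n : ℕ) : Type := Idx n → ℂ

/-- The Kronecker product `M 0 ⊗ ⋯ ⊗ M (k-1)`, `k = ⌊n/2⌋`, as an endomorphism of
`ℂ² ⊗ ⋯ ⊗ ℂ²` written as a matrix in the standard basis. -/
def tensorMatrix (n : ℕ) (M : ℕ → Matrix (Fin 2) (Fin 2) ℂ) : Matrix (Idx n) (Idx n) ℂ :=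
  fun s t => ∏ r : Fin (n / 2), M r (s r) (t r)

/-- The matrix `g₁ = diag(i, -i)`. -/
def g₁ : Matrix (Fin 2) (Fin 2) ℂ := !![Complex.I, 0; 0, -Complex.I]

/-- The matrix `g₂` with both off-diagonal entries `i`. -/
def g₂ : Matrix (Fin 2) (Fin 2) ℂ := !![0, Complex.I; Complex.I, 0]

/-- The matrix `T = i g₁ g₂`. -/
def T : Matrix (Fin 2) (Fin 2) ℂ := !![0, -Complex.I; Complex.I, 0]

/-- The matrix by which the (0-based) basis vector `e_a` acts on the `r`-th factor `ℂ²`: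
`T` for `r < ⌊a/2⌋`, `g₁` or `g₂` (according to the parity of `a`) for `r = ⌊a/2⌋`, and
the identity for `r > ⌊a/2⌋`. -/
def site (a r : ℕ) : Matrix (Fin 2) (Fin 2) ℂ :=
  if r < a / 2 then T else if r = a / 2 then (if a % 2 = 0 then g₁ else g₂) else 1

/-- The scalar `1`, except that it is `i` for the last basis vector when `n` is odd. -/
def phase (n a : ℕ) : ℂ := if a / 2 < n / 2 then 1 else Complex.I

/-- Clifford multiplication by the (0-based) basis vector `e_a` on `Δₙ`. With the tensor factors
written from right to left, the basis vectors number `2j` and `2j+1` act as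
`1 ⊗ ⋯ ⊗ 1 ⊗ g₁ ⊗ T ⊗ ⋯ ⊗ T` and `1 ⊗ ⋯ ⊗ 1 ⊗ g₂ ⊗ T ⊗ ⋯ ⊗ T`, with `j` factors `T`;
for odd `n` the last basis vector acts as `i T ⊗ ⋯ ⊗ T`. -/
def gamma (n : ℕ) (a : Fin n) : Matrix (Idx n) (Idx n) ℂ :=
  phase n a • tensorMatrix n (site a)

theorem tensorMatrix_mul (n : ℕ) (A B : ℕ → Matrix (Fin 2) (Fin 2) ℂ) :
    tensorMatrix n A * tensorMatrix n B = tensorMatrix n fun r => A r * B r := by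
  ext s t
  simp only [tensorMatrix, Matrix.mul_apply, ← Finset.prod_mul_distrib, Finset.prod_univ_sum,
    Fintype.piFinset_univ]

theorem tensorMatrix_smul (n : ℕ) (c : ℕ → ℂ) (A : ℕ → Matrix (Fin 2) (Fin 2) ℂ) :
    tensorMatrix n (fun r => c r • A r) = (∏ r : Fin (n / 2), c r) • tensorMatrix n A := by
  ext s t
  simp [tensorMatrix, Finset.prod_mul_distrib]

theorem tensorMatrix_one (n : ℕ) : tensorMatrix n (fun _ => 1) = 1 := by
  ext s t
  simp [tensorMatrix, Matrix.one_apply, Finset.prod_ite_zero, funext_iff]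

theorem prod_sign (k j : ℕ) :
    (∏ r : Fin k, if (r : ℕ) = j then (-1 : ℂ) else 1) = if j < k then -1 else 1 := by
  rw [Fin.prod_univ_eq_prod_range (fun r => if r = j then (-1 : ℂ) else 1) k,
    Finset.prod_ite_eq']
  simp

theorem g₁_sq : g₁ * g₁ = -1 := by
  ext i j; fin_cases i <;> fin_cases j <;> simp [g₁, Matrix.mul_apply]

theorem g₂_sq : g₂ * g₂ = -1 := by
  ext i j; fin_cases i <;> fin_cases j <;> simp [g₂, Matrix.mul_apply]

theorem T_sq : T * T = 1 := by
  ext i j; fin_cases i <;> fin_cases j <;> simp [T, Matrix.mul_apply]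

theorem g₁_mul_g₂ : g₁ * g₂ = -(g₂ * g₁) := by
  ext i j; fin_cases i <;> fin_cases j <;> simp [g₁, g₂, Matrix.mul_apply]

theorem g₁_mul_T : g₁ * T = -(T * g₁) := by
  ext i j; fin_cases i <;> fin_cases j <;> simp [g₁, T, Matrix.mul_apply]

theorem g₂_mul_T : g₂ * T = -(T * g₂) := by
  ext i j; fin_cases i <;> fin_cases j <;> simp [g₂, T, Matrix.mul_apply]

theorem site_sq (a r : ℕ) :
    site a r * site a r = (if r = a / 2 then (-1 : ℂ) else 1) • 1 := by
  unfold site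
  split_ifs <;> first | omega | simp [T_sq, g₁_sq, g₂_sq]

theorem site_mul (a b r : ℕ) (h : a < b) :
    site a r * site b r = (if r = a / 2 then (-1 : ℂ) else 1) • (site b r * site a r) := by
  unfold site
  split_ifs <;> first | omega | simp [g₁_mul_g₂, g₁_mul_T, g₂_mul_T]

theorem gamma_sq (n : ℕ) (a : Fin n) : gamma n a * gamma n a = -1 := by
  have h := tensorMatrix_mul n (site a) (site a)
  simp only [site_sq] at h
  rw [tensorMatrix_smul n (fun r => if r = (a : ℕ) / 2 then (-1 : ℂ) else 1), prod_sign,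
    tensorMatrix_one] at h
  rw [gamma, smul_mul_smul_comm, h, smul_smul, phase]
  split_ifs <;> simp

theorem gamma_mul_of_lt (n : ℕ) {a b : Fin n} (hab : a < b) :
    gamma n a * gamma n b = -(gamma n b * gamma n a) := by
  have hlt : (a : ℕ) / 2 < n / 2 := by have := b.isLt; have : (a : ℕ) < b := hab; omega
  have h := tensorMatrix_mul n (site a) (site b)
  simp only [site_mul a b _ hab] at h
  rw [tensorMatrix_smul n (fun r => if r = (a : ℕ) / 2 then (-1 : ℂ) else 1), prod_sign,
    if_pos hlt, ← tensorMatrix_mul] at h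
  rw [gamma, gamma, smul_mul_smul_comm, smul_mul_smul_comm, h, mul_comm (phase n b), neg_one_smul,
    smul_neg]

theorem gamma_mul (n : ℕ) {a b : Fin n} (hab : a ≠ b) :
    gamma n a * gamma n b = -(gamma n b * gamma n a) := by
  rcases lt_or_gt_of_ne hab with h | h
  · exact gamma_mul_of_lt n h
  · rw [gamma_mul_of_lt n h, neg_neg]

/-- Clifford multiplication by vectors of `ℝⁿ` on spinors. -/
def cliffordMul (n : ℕ) : (Fin n → ℝ) →ₗ[ℝ] Matrix (Idx n) (Idx n) ℂ where
  toFun v := ∑ a, (v a : ℂ) • gamma n a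
  map_add' v w := by simp [add_smul, Finset.sum_add_distrib]
  map_smul' c v := by
    simp only [Pi.smul_apply, smul_eq_mul, Complex.ofReal_mul, mul_smul, RingHom.id_apply,
      Finset.smul_sum]
    refine Finset.sum_congr rfl fun a _ => ?_
    exact Complex.coe_smul c _

theorem cliffordMul_sq (n : ℕ) (v : Fin n → ℝ) :
    cliffordMul n v * cliffordMul n v = algebraMap ℝ _ (form n v) := by
  have key : ∀ a b : Fin n, ((v a : ℂ) • gamma n a) * ((v b : ℂ) • gamma n b) +
      ((v b : ℂ) • gamma n b) * ((v a : ℂ) • gamma n a) =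
      if a = b then (-2 * (v a * v a) : ℂ) • (1 : Matrix (Idx n) (Idx n) ℂ) else 0 := by
    intro a b
    rw [smul_mul_smul_comm, smul_mul_smul_comm]
    split_ifs with h
    · subst h
      rw [gamma_sq, smul_neg, ← neg_smul, ← add_smul]
      congr 1; ring
    · rw [gamma_mul n h, mul_comm (v b : ℂ), smul_neg, neg_add_cancel]
  have h2 : (2 : ℂ) • (cliffordMul n v * cliffordMul n v) =
      (2 : ℂ) • algebraMap ℝ (Matrix (Idx n) (Idx n) ℂ) (form n v) := by
    have e : cliffordMul n v * cliffordMul n v =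
        ∑ a, ∑ b, ((v a : ℂ) • gamma n a) * ((v b : ℂ) • gamma n b) := by
      change (∑ a, (v a : ℂ) • gamma n a) * (∑ a, (v a : ℂ) • gamma n a) = _
      rw [Finset.sum_mul_sum]
    have e' : cliffordMul n v * cliffordMul n v =
        ∑ a, ∑ b, ((v b : ℂ) • gamma n b) * ((v a : ℂ) • gamma n a) := by
      rw [e, Finset.sum_comm]
    rw [two_smul]
    nth_rewrite 1 [e]
    rw [e', ← Finset.sum_add_distrib]
    simp_rw [← Finset.sum_add_distrib, key]
    simp only [Finset.sum_ite_eq, Finset.mem_univ, if_true]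
    rw [← Finset.sum_smul, Algebra.algebraMap_eq_smul_one,
      ← Complex.coe_smul (form n v) (1 : Matrix (Idx n) (Idx n) ℂ), smul_smul]
    congr 1
    simp [Finset.mul_sum]
  exact smul_right_injective _ (two_ne_zero (α := ℂ)) h2

/-- The action of the Clifford algebra on spinors. For odd `n` its complexification is one of the
two irreducible representations of the complex Clifford algebra, and for even `n` it is the
irreducible one. -/
def cliffordAction (n : ℕ) : Cl n →ₐ[ℝ] Matrix (Idx n) (Idx n) ℂ :=
  CliffordAlgebra.lift (form n) ⟨cliffordMul n, cliffordMul_sq n⟩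

/-- The spin representation `κ` of `Spin(n)` on `Δₙ`. -/
def kappa (n : ℕ) : Representation ℂ (Spin n) (Spinor n) :=
  ((Matrix.toLinAlgEquiv' : Matrix (Idx n) (Idx n) ℂ ≃ₐ[ℂ] Module.End ℂ (Spinor n)) :
    Matrix (Idx n) (Idx n) ℂ →* Module.End ℂ (Spinor n)).comp
    ((cliffordAction n : Cl n →* Matrix (Idx n) (Idx n) ℂ).comp (spinGroup (form n)).subtype)

/-- The map `(g, z₁, z₂) ↦ z₁² z₂ κ(g)` on `Spin(n) × S¹ × S¹`. -/
def kappaTLift (n : ℕ) : Representation ℂ (Spin n × Circle × Circle) (Spinor n) where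
  toFun x := ((x.2.1 : ℂ) ^ 2 * (x.2.2 : ℂ)) • kappa n x.1
  map_one' := by simp
  map_mul' x y := by
    simp only [Prod.fst_mul, Prod.snd_mul, Circle.coe_mul, map_mul, smul_mul_smul_comm]
    congr 1; ring

/-- The representation `κ^T` of `Spin^T(n)` on `Δₙ`: `κ^T[g, z₁, z₂]ψ = z₁² z₂ κ(g)ψ`. -/
def kappaT (n : ℕ) : Representation ℂ (SpinT n) (Spinor n) :=
  QuotientGroup.lift (signSubgroup n) (kappaTLift n) (by
    rintro x (rfl | ⟨h1, h2, h3⟩)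
    · exact map_one _
    · change ((x.2.1 : ℂ) ^ 2 * (x.2.2 : ℂ)) •
        Matrix.toLinAlgEquiv' (cliffordAction n (x.1 : Cl n)) = 1
      rw [h1, h2, h3, map_neg, map_neg, map_one, map_one]
      simp)

theorem kappaT_mk (n : ℕ) (g : Spin n) (z₁ z₂ : Circle) (ψ : Spinor n) :
    kappaT n (SpinT.mk g z₁ z₂) ψ = ((z₁ : ℂ) ^ 2 * (z₂ : ℂ)) • kappa n g ψ :=
  rfl

end SpinRep

end

/-!
The products `e_a e_b` of two basis vectors lie in `Spin(n)`, and `[e_a e_b, 1, 1]` acts on spinors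
by `γ_a γ_b`. Since `g₁ g₂ = -i T`, the product `γ_{2j} γ_{2j+1}` is, up to a scalar, `T` on the
`j`-th tensor factor alone. For odd `n`, the product of `γ_{2j}` with the last `γ` is, up to a
scalar, `g₁ T` on the `j`-th factor and `T` on the later ones; cancelling these factors `T` isolates
`g₁` on the `j`-th factor. As `g₁` and `T` generate `M₂(ℂ)`, the group spans all endomorphisms of
the spinor space, so no proper nonzero subspace can be invariant.
-/

namespace SpinRep

theorem isIrreducible_of_adjoin_range_eq_top {k G V : Type*} [Field k] [Monoid G]
    [AddCommGroup V] [Module k V] [Nontrivial V] (ρ : Representation k G V)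
    (hρ : Algebra.adjoin k (Set.range ρ) = ⊤) : ρ.IsIrreducible := by
  have : Nontrivial (Subrepresentation ρ) :=
    ⟨⊥, ⊤, fun h => bot_ne_top (congrArg Subrepresentation.toSubmodule h)⟩
  refine ⟨fun W => ?_⟩
  have invariant (f : Module.End k V) : ∀ v ∈ W.toSubmodule, f v ∈ W.toSubmodule := by
    have hf : f ∈ Algebra.adjoin k (Set.range ρ) := hρ ▸ Algebra.mem_top
    induction hf using Algebra.adjoin_induction with
    | mem f hf =>
      obtain ⟨g, rfl⟩ := hf
      exact W.apply_mem_toSubmodule g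
    | algebraMap c => exact fun v hv => W.toSubmodule.smul_mem c hv
    | add _ _ _ _ hf hg => exact fun v hv => add_mem (hf v hv) (hg v hv)
    | mul _ _ _ _ hf hg => exact fun v hv => hf _ (hg v hv)
  let W' : Submodule (Module.End k V) V := { W.toSubmodule with smul_mem' := invariant }
  exact (eq_bot_or_eq_top W').imp (fun h : W' = ⊥ => SetLike.ext (SetLike.ext_iff.1 h :))
    (fun h : W' = ⊤ => SetLike.ext (SetLike.ext_iff.1 h :))

section PiKronecker

variable {R ι : Type*} {m : ι → Type*} [CommSemiring R] [Fintype ι]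

/-- The Kronecker product `⨂ i, M i` of a finite family of square matrices, with rows and columns
indexed by `∀ i, m i`; `tensorMatrix` is the case of `2 × 2` complex matrices. -/
def piKronecker (M : ∀ i, Matrix (m i) (m i) R) : Matrix (∀ i, m i) (∀ i, m i) R :=
  Matrix.of fun s t => ∏ i, M i (s i) (t i)

@[simp]
theorem piKronecker_apply (M : ∀ i, Matrix (m i) (m i) R) (s t : ∀ i, m i) :
    piKronecker M s t = ∏ i, M i (s i) (t i) :=
  rfl

theorem single_eq_piKronecker [∀ i, DecidableEq (m i)] (s t : ∀ i, m i) :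
    Matrix.single s t (1 : R) = piKronecker fun i => Matrix.single (s i) (t i) 1 := by
  ext s' t'
  simp [Matrix.single_apply, Finset.prod_ite_zero, funext_iff, forall_and]

variable [DecidableEq ι]

theorem piKronecker_update_apply (M : ∀ i, Matrix (m i) (m i) R) (i : ι) (A : Matrix (m i) (m i) R)
    (s t : ∀ i, m i) : piKronecker (Function.update M i A) s t =
      A (s i) (t i) * ∏ j ∈ Finset.univ.erase i, M j (s j) (t j) := by
  rw [piKronecker_apply, ← Finset.mul_prod_erase _ _ (Finset.mem_univ i), Function.update_self]
  refine congrArg _ (Finset.prod_congr rfl fun j hj => ?_)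
  rw [Function.update_of_ne (Finset.ne_of_mem_erase hj)]

variable [∀ i, Fintype (m i)] [∀ i, DecidableEq (m i)]

/-- `piKronecker` as a monoid homomorphism. -/
def piKroneckerHom : (∀ i, Matrix (m i) (m i) R) →* Matrix (∀ i, m i) (∀ i, m i) R where
  toFun := piKronecker
  map_one' := by
    ext s t
    simp [Matrix.one_apply, Finset.prod_ite_zero, funext_iff]
  map_mul' M N := by
    ext s t
    simp [Matrix.mul_apply, ← Finset.prod_mul_distrib, Finset.prod_univ_sum]

/-- The action `1 ⊗ ⋯ ⊗ A ⊗ ⋯ ⊗ 1` of a matrix on the `i`-th tensor factor. -/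
def factorEmbedding (i : ι) :
    Matrix (m i) (m i) R →ₐ[R] Matrix (∀ i, m i) (∀ i, m i) R :=
  AlgHom.ofLinearMap
    { toFun := fun A => piKronecker (Pi.mulSingle i A)
      map_add' := fun A B => by
        ext s t
        simp only [Pi.mulSingle, piKronecker_update_apply, Matrix.add_apply, add_mul]
      map_smul' := fun c A => by
        ext s t
        simp only [Pi.mulSingle, piKronecker_update_apply, Matrix.smul_apply, smul_mul_assoc,
          RingHom.id_apply] }
    (map_one (piKroneckerHom.comp (MonoidHom.mulSingle _ i)))
    (map_mul (piKroneckerHom.comp (MonoidHom.mulSingle _ i)))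

theorem factorEmbedding_apply (i : ι) (A : Matrix (m i) (m i) R) :
    factorEmbedding i A = piKronecker (Pi.mulSingle i A) :=
  rfl

theorem piKronecker_mem_of_factorEmbedding_mem (M : ∀ i, Matrix (m i) (m i) R)
    {S : Subalgebra R (Matrix (∀ i, m i) (∀ i, m i) R)} (h : ∀ i, factorEmbedding i (M i) ∈ S) :
    piKronecker M ∈ S :=
  Submonoid.pi_mem_of_mulSingle_mem (H := S.toSubmonoid.comap piKroneckerHom) M h

theorem iSup_range_factorEmbedding_eq_top :
    ⨆ i, (factorEmbedding (R := R) (m := m) i).range = ⊤ := by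
  refine Algebra.eq_top_iff.2 fun A => ?_
  rw [Matrix.matrix_eq_sum_single A]
  refine sum_mem fun s _ => sum_mem fun t _ => ?_
  rw [← mul_one (A s t), ← smul_eq_mul, ← Matrix.smul_single, single_eq_piKronecker]
  exact Subalgebra.smul_mem _ (piKronecker_mem_of_factorEmbedding_mem _ fun i =>
    le_iSup (fun i => (factorEmbedding (R := R) (m := m) i).range) i ⟨_, rfl⟩) _

end PiKronecker

theorem g₁_mul_g₂_eq_smul_T : g₁ * g₂ = (-Complex.I) • T := by
  ext i j
  fin_cases i <;> fin_cases j <;> simp [g₁, g₂, T]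

theorem eq_smul_one_add_smul_g₁_add_smul_T_add_smul_g₁_mul_T (A : Matrix (Fin 2) (Fin 2) ℂ) :
    A = ((A 0 0 + A 1 1) / 2) • (1 : Matrix (Fin 2) (Fin 2) ℂ) +
      ((A 1 1 - A 0 0) / 2 * Complex.I) • g₁ + ((A 0 1 - A 1 0) / 2 * Complex.I) • T +
      ((A 0 1 + A 1 0) / 2) • (g₁ * T) := by
  ext i j
  fin_cases i <;> fin_cases j <;> simp [g₁, T] <;> ring_nf <;> simp only [Complex.I_sq] <;> ring

theorem adjoin_g₁_T_eq_top : Algebra.adjoin ℂ {g₁, T} = ⊤ := by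
  refine Algebra.eq_top_iff.2 fun A => ?_
  have hg₁ : g₁ ∈ Algebra.adjoin ℂ {g₁, T} := Algebra.subset_adjoin (Set.mem_insert _ _)
  have hT : T ∈ Algebra.adjoin ℂ {g₁, T} :=
    Algebra.subset_adjoin (Set.mem_insert_of_mem _ rfl)
  rw [eq_smul_one_add_smul_g₁_add_smul_T_add_smul_g₁_mul_T A]
  exact add_mem (add_mem (add_mem (Subalgebra.smul_mem _ (one_mem _) _)
    (Subalgebra.smul_mem _ hg₁ _)) (Subalgebra.smul_mem _ hT _))
    (Subalgebra.smul_mem _ (mul_mem hg₁ hT) _)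

theorem eq_top_of_factorEmbedding_mem {ι : Type*} [Fintype ι] [DecidableEq ι]
    {S : Subalgebra ℂ (Matrix (ι → Fin 2) (ι → Fin 2) ℂ)}
    (hg₁ : ∀ i : ι, factorEmbedding i g₁ ∈ S) (hT : ∀ i : ι, factorEmbedding i T ∈ S) : S = ⊤ := by
  refine top_unique (iSup_range_factorEmbedding_eq_top.symm.trans_le (iSup_le fun i => ?_))
  rw [← Algebra.map_top, ← adjoin_g₁_T_eq_top, AlgHom.map_adjoin, Algebra.adjoin_le_iff,
    Set.image_pair]
  exact Set.pair_subset (hg₁ i) (hT i)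

/-- The involution acting by `T` on the tensor factors with index at least `j`; multiplication by it
cancels these factors `T` in a Clifford product. -/
def tailInvolution (n j : ℕ) : Matrix (Idx n) (Idx n) ℂ :=
  tensorMatrix n fun r => if r < j then 1 else T

theorem tailInvolution_mul_self (n j : ℕ) : tailInvolution n j * tailInvolution n j = 1 := by
  rw [tailInvolution, tensorMatrix_mul, ← tensorMatrix_one]
  congr 1 with r : 1
  split_ifs <;> simp [T_sq]

theorem tensorMatrix_congr {n : ℕ} {A B : ℕ → Matrix (Fin 2) (Fin 2) ℂ}
    (h : ∀ r < n / 2, A r = B r) : tensorMatrix n A = tensorMatrix n B := by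
  ext s t
  exact Finset.prod_congr rfl fun r _ => by rw [h r r.isLt]

theorem factorEmbedding_eq_tensorMatrix {n : ℕ} (j : Fin (n / 2)) (A : Matrix (Fin 2) (Fin 2) ℂ) :
    factorEmbedding j A = tensorMatrix n fun r => if r = j then A else 1 := by
  ext s t
  simp only [factorEmbedding_apply, piKronecker_apply, tensorMatrix, Pi.mulSingle_apply,
    Fin.ext_iff]

theorem site_two_mul_mul_site_two_mul_add_one (j r : ℕ) :
    site (2 * j) r * site (2 * j + 1) r = if r = j then g₁ * g₂ else 1 := by
  simp only [site]
  split_ifs <;> first | omega | simp [T_sq]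

theorem site_two_mul_mul_site_two_mul (j : ℕ) {k r : ℕ} (hr : r < k) :
    site (2 * j) r * site (2 * k) r = (if r = j then g₁ else 1) * (if r < j then 1 else T) := by
  simp only [site]
  split_ifs <;> first | omega | simp [T_sq]

theorem gamma_two_mul_mul_gamma_two_mul_add_one {n : ℕ} (j : Fin (n / 2)) :
    gamma n ⟨2 * j, by omega⟩ * gamma n ⟨2 * j + 1, by omega⟩ =
      (-Complex.I) • factorEmbedding j T := by
  have hphase : phase n (2 * j) = 1 := if_pos (by omega)
  have hphase' : phase n (2 * j + 1) = 1 := if_pos (by omega)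
  rw [← map_smul, ← g₁_mul_g₂_eq_smul_T, factorEmbedding_eq_tensorMatrix, gamma, gamma, hphase,
    hphase', one_smul, one_smul, tensorMatrix_mul]
  exact congrArg _ (funext (site_two_mul_mul_site_two_mul_add_one j))

theorem gamma_two_mul_mul_gamma_last {k : ℕ} (j : Fin ((2 * k + 1) / 2)) :
    gamma (2 * k + 1) ⟨2 * j, by omega⟩ * gamma (2 * k + 1) (Fin.last (2 * k)) =
      Complex.I • (factorEmbedding j g₁ * tailInvolution (2 * k + 1) j) := by
  have hphase : phase (2 * k + 1) (2 * j) = 1 := if_pos (by omega)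
  have hphase' : phase (2 * k + 1) (Fin.last (2 * k)) = Complex.I :=
    if_neg (by rw [Fin.val_last]; omega)
  rw [factorEmbedding_eq_tensorMatrix, tailInvolution, gamma, gamma, hphase, hphase', one_smul,
    mul_smul_comm, tensorMatrix_mul, tensorMatrix_mul]
  exact congrArg _ <| tensorMatrix_congr fun r hr =>
    site_two_mul_mul_site_two_mul j (by omega)

section Generation

variable {n : ℕ} {S : Subalgebra ℂ (Matrix (Idx n) (Idx n) ℂ)}

theorem factorEmbedding_T_mem (hS : ∀ a b, gamma n a * gamma n b ∈ S) (j : Fin (n / 2)) :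
    factorEmbedding j T ∈ S := by
  have h := S.smul_mem (hS ⟨2 * j, by omega⟩ ⟨2 * j + 1, by omega⟩) Complex.I
  rw [gamma_two_mul_mul_gamma_two_mul_add_one j, smul_smul] at h
  simpa using h

theorem tailInvolution_mem (hS : ∀ a b, gamma n a * gamma n b ∈ S) (j : ℕ) :
    tailInvolution n j ∈ S := by
  refine piKronecker_mem_of_factorEmbedding_mem _ fun i => ?_
  split_ifs
  · simp only [map_one, one_mem]
  · exact factorEmbedding_T_mem hS i

theorem factorEmbedding_g₁_mem (hn : Odd n) (hS : ∀ a b, gamma n a * gamma n b ∈ S)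
    (j : Fin (n / 2)) : factorEmbedding j g₁ ∈ S := by
  obtain ⟨k, rfl⟩ := hn
  have h := S.smul_mem (mul_mem (hS ⟨2 * j, by omega⟩ (Fin.last _)) (tailInvolution_mem hS j))
    (-Complex.I)
  rw [gamma_two_mul_mul_gamma_last j, smul_mul_assoc, mul_assoc, tailInvolution_mul_self,
    mul_one, smul_smul] at h
  simpa using h

theorem eq_top_of_gamma_mul_gamma_mem (hn : Odd n) (hS : ∀ a b, gamma n a * gamma n b ∈ S) :
    S = ⊤ :=
  eq_top_of_factorEmbedding_mem (factorEmbedding_g₁_mem hn hS) (factorEmbedding_T_mem hS)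

end Generation

open CliffordAlgebra

section SpinGroup

variable {R M : Type*} [CommRing R] [AddCommGroup M] [Module R M] {Q : QuadraticForm R M} {v w : M}

theorem ι_mem_pinGroup (hv : Q v = -1) : ι Q v ∈ pinGroup Q := by
  have hsq : ι Q v * ι Q v = -1 := by rw [ι_sq_scalar, hv, map_neg, map_one]
  refine pinGroup.mem_iff.2 ⟨⟨⟨ι Q v, -ι Q v, ?_, ?_⟩, Subgroup.subset_closure ⟨v, rfl⟩, rfl⟩,
    Unitary.mem_iff.2 ⟨?_, ?_⟩⟩ <;>
  simp only [star_ι, neg_mul, mul_neg, hsq, neg_neg]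

theorem ι_mul_ι_mem_spinGroup (hv : Q v = -1) (hw : Q w = -1) : ι Q v * ι Q w ∈ spinGroup Q :=
  spinGroup.mem_iff.2 ⟨mul_mem (ι_mem_pinGroup hv) (ι_mem_pinGroup hw),
    ι_mul_ι_mem_evenOdd_zero _ _ _⟩

end SpinGroup

theorem form_single (n : ℕ) (a : Fin n) : form n (Pi.single a 1) = -1 := by
  simp [QuadraticMap.weightedSumSquares_apply, Pi.single_apply]

theorem cliffordMul_single (n : ℕ) (a : Fin n) : cliffordMul n (Pi.single a 1) = gamma n a := by
  change ∑ b, ((Pi.single a 1 : Fin n → ℝ) b : ℂ) • gamma n b = gamma n a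
  simp [Pi.single_apply, apply_ite Complex.ofReal]

theorem toLin'_gamma_mul_gamma_mem_range_kappa (n : ℕ) (a b : Fin n) :
    Matrix.toLin' (gamma n a * gamma n b) ∈ Set.range (kappa n) := by
  refine ⟨⟨_, ι_mul_ι_mem_spinGroup (form_single n a) (form_single n b)⟩, ?_⟩
  change Matrix.toLin' (cliffordAction n (ι (form n) _ * ι (form n) _)) = _
  rw [map_mul, cliffordAction, lift_ι_apply, lift_ι_apply, cliffordMul_single, cliffordMul_single]

theorem adjoin_range_kappa_eq_top {n : ℕ} (hn : Odd n) :
    Algebra.adjoin ℂ (Set.range (kappa n)) = ⊤ := by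
  let toEnd : Matrix (Idx n) (Idx n) ℂ ≃ₐ[ℂ] Module.End ℂ (Spinor n) := Matrix.toLinAlgEquiv'
  have hcomap : (Algebra.adjoin ℂ (Set.range (kappa n))).comap toEnd.toAlgHom = ⊤ :=
    eq_top_of_gamma_mul_gamma_mem hn fun a b =>
      Algebra.subset_adjoin (toLin'_gamma_mul_gamma_mem_range_kappa n a b)
  refine Algebra.eq_top_iff.2 fun f => ?_
  have hf : toEnd.symm f ∈ (Algebra.adjoin ℂ (Set.range (kappa n))).comap toEnd.toAlgHom :=
    hcomap ▸ Algebra.mem_top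
  simpa using hf

theorem range_kappa_subset_range_kappaT (n : ℕ) :
    Set.range (kappa n) ⊆ Set.range (kappaT n) := by
  rintro _ ⟨g, rfl⟩
  exact ⟨SpinT.mk g 1 1, LinearMap.ext fun ψ => by simp [kappaT_mk]⟩

end SpinRep

/-- For odd `n`, the representation `κ^T` of `Spin^T(n)` on the spinor space is irreducible. -/
theorem mainTheorem4 (n : ℕ) (hn : Odd n) : (SpinRep.kappaT n).IsIrreducible := by
  have hspan : Algebra.adjoin ℂ (Set.range (SpinRep.kappaT n)) = ⊤ :=
    top_unique <| (SpinRep.adjoin_range_kappa_eq_top hn).symm.trans_le <|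
      Algebra.adjoin_mono (SpinRep.range_kappa_subset_range_kappaT n)
  exact SpinRep.isIrreducible_of_adjoin_range_eq_top _ hspan
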